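/- Let $(M,g)$ be a compact connected smooth Riemannian manifold (without boundary) with Riemannian distance $d$, and let $x_0\in M$. A covering space $p\colon Y\to M$ is called *trivial over* a subset $Z\subseteq M$ if $p^{-1}(Z)$ is a disjoint union of open subspaces of $p^{-1}(Z)$, each mapped homeomorphically onto $Z$ by $p$; it is *trivial* if it is trivial over $M$. For $\delta\in[0,\infty]$ it is *$\delta$-trivial* if it is trivial over the open ball of radius $\delta$ centred at each point of $M$. The *covering radius* is $r(Y/M)=\sup\{\delta\in[0,\infty] : Y \text{ is } \delta\text{-trivial over } M\}$. The *covering spectrum* $\operatorname{CovSpec}(M,g)\subseteq[0,\infty]$ is the set of all $r(Y/M)$, where $Y$ runs over the non-trivial covering spaces of $M$ of constant degree (all fibres have the same cardinality). For $\gamma\in\pi_1(M,x_0)$ let $m_g(\gamma)$, the *minimum marked length* of $\gamma$, be the infimum of the lengths of all (piecewise) $C^1$ loops in $M$ that are freely homotopic to $\gamma$. For $\delta>0$ let $$\operatorname{Fil}^\delta_{m_g}\pi_1(M,x_0)=\langle \gamma\in\pi_1(M,x_0) : m_g(\gamma)<\delta\rangle ,$$ and let $\operatorname{Jump}(\operatorname{Fil}^\bullet_{m_g}\pi_1(M,x_0))$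 be the set of all $\delta>0$ such that $\operatorname{Fil}^\delta_{m_g}\pi_1(M,x_0)\neq \operatorname{Fil}^\varepsilon_{m_g}\pi_1(M,x_0)$ for every $\varepsilon>\delta$. Then $$\operatorname{CovSpec}(M,g)=\tfrac12\operatorname{Jump}\bigl(\operatorname{Fil}^\bullet_{m_g}\pi_1(M,x_0)\bigr)=\{\delta/2 : \delta\in\operatorname{Jump}(\operatorname{Fil}^\bullet_{m_g}\pi_1(M,x_0))\}.$$ -/

import Mathlib

open scoped ENNReal Manifold ContDiff Bundle

namespace CoveringSpectrum

noncomputable section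

universe u

/-! ### Covering spaces and the covering spectrum of a metric space -/

/-- A space `p : Y → X` over `X` is trivial over `Z ⊆ X` (it evenly covers `Z`) if `p ⁻¹' Z` is the
disjoint union of a family `S` of open subspaces of `p ⁻¹' Z` (the sheets), each of which is mapped
homeomorphically onto `Z` by `p`. -/
def IsTrivialOver {X Y : Type*} [TopologicalSpace X] [TopologicalSpace Y]
    (p : Y → X) (Z : Set X) : Prop :=
  ∃ S : Set (Set (p ⁻¹' Z)),
    (∀ V ∈ S, IsOpen V) ∧ S.PairwiseDisjoint id ∧ ⋃₀ S = Set.univ ∧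
    ∀ V ∈ S, IsHomeomorph (fun y : V ↦ Z.restrictPreimage p y)

/-- `Y` is `δ`-trivial over the metric space `X`, for `δ ∈ [0, ∞]`, if it is trivial over the open
ball of radius `δ` centred at each point of `X`. -/
def IsDeltaTrivial {X Y : Type*} [MetricSpace X] [TopologicalSpace Y]
    (p : Y → X) (δ : ℝ≥0∞) : Prop :=
  ∀ x : X, IsTrivialOver p (Metric.eball x δ)

/-- The covering radius `r(Y/X) ∈ [0, ∞]`. -/
def coveringRadius {X Y : Type*} [MetricSpace X] [TopologicalSpace Y] (p : Y → X) : ℝ≥0∞ :=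
  sSup {δ : ℝ≥0∞ | IsDeltaTrivial p δ}

/-- The covering spectrum of a metric space `X`: the set of all `r(Y/X)`, where `p : Y → X` runs
over the non-trivial covering spaces of `X` of constant degree. -/
def covSpec (X : Type u) [MetricSpace X] : Set ℝ≥0∞ :=
  {r | ∃ (Y : Type u) (_ : TopologicalSpace Y) (p : Y → X),
    IsCoveringMap p ∧
    (∀ x x' : X, Cardinal.mk (p ⁻¹' {x}) = Cardinal.mk (p ⁻¹' {x'})) ∧
    ¬ IsTrivialOver p Set.univ ∧
    r = coveringRadius p}

/-! ### The filtration of a group given by a map to `[0, ∞]`, and its jump set -/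

/-- `Fil_m^δ G = ⟨g ∈ G : m(g) < δ⟩`. -/
def lengthFiltration {G : Type*} [Group G] (m : G → ℝ≥0∞) (δ : ℝ) : Subgroup G :=
  Subgroup.closure {g : G | m g < ENNReal.ofReal δ}

/-- The jump set of a family of subgroups indexed by the positive real numbers: all `δ > 0` such
that `Fil^δ G ≠ Fil^ε G` for every `ε > δ`. -/
def jumpSet {G : Type*} [Group G] (Fil : ℝ → Subgroup G) : Set ℝ :=
  {δ | 0 < δ ∧ ∀ ε : ℝ, δ < ε → Fil δ ≠ Fil ε}

/-! ### The minimum marked length map of a Riemannian manifold -/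

/-- Two loops, with possibly different base points, are freely homotopic if they are homotopic
through loops. -/
def FreelyHomotopic {X : Type*} [TopologicalSpace X] {x y : X}
    (σ : Path x x) (τ : Path y y) : Prop :=
  ContinuousMap.HomotopicWith σ.toContinuousMap τ.toContinuousMap
    (fun f : C(unitInterval, X) ↦ f 0 = f 1)

/-- The minimum marked length `m_g : π₁(M, x₀) → [0, ∞]`: it sends a class to the infimum of the
lengths of all loops `τ` (with any base point) that are freely homotopic to it. Here the loops are
`C^1` paths `[0, 1] → M` with equal end points (as in Mathlib's `Manifold.riemannianEDist`, no
condition is put on the velocities at the end points), and the length is the integral of the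
Riemannian norm of the velocity. -/
def minMarkedLength {n : ℕ} {M : Type*} [TopologicalSpace M]
    [ChartedSpace (EuclideanSpace ℝ (Fin n)) M]
    [Bundle.RiemannianBundle (fun x : M ↦ TangentSpace (𝓡 n) x)]
    {x₀ : M} (γ : FundamentalGroup M x₀) : ℝ≥0∞ :=
  sInf {L : ℝ≥0∞ | ∃ (σ : Path x₀ x₀) (y : M) (τ : Path y y),
    FundamentalGroup.fromPath (Path.Homotopic.Quotient.mk σ) = γ ∧
    FreelyHomotopic σ τ ∧
    ContMDiffOn 𝓘(ℝ) (𝓡 n) 1 τ.extend (Set.Icc 0 1) ∧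
    L = Manifold.pathELength (𝓡 n) τ.extend 0 1}

end

end CoveringSpectrum

/-! The bridge is `isDeltaTrivial_iff`: a covering is `δ/2`-trivial exactly when `Fil^δ` acts
trivially on the fibre over `x₀`. A loop shorter than `δ` stays in the open ball of radius `δ/2`
about its base point, so triviality over balls kills its monodromy. Conversely, if such loops act
trivially, transport to the centre along short paths trivialises each ball (`isTrivialOver_eball`).

Compactness makes the covering radius `r` of a non-trivial covering positive and finite. Since `Fil`
is defined by a strict inequality, `Fil^(2r)` still acts trivially; if it equalled `Fil^ε` for some
`ε > 2r`, the covering would be `ε/2`-trivial, contradicting the choice of `r`. So `2r` is a jump.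

Conversely, `Fil^δ` is normal because marked length is invariant under conjugation. A covering with
fibre `π₁/Fil^δ` is glued from products over balls of radius `δ/2`, with transition functions given
by holonomy of short paths (`Holonomy.exists_isCoveringMap`). It is `ε/2`-trivial only if `Fil^ε ≤
Fil^δ`, so at a jump `δ` its radius is exactly `δ/2`. -/

namespace CoveringSpectrum

open Topology Manifold
open Path (Homotopic)

/-! ### Free homotopy as conjugacy in the fundamental groupoid -/

section FreeHomotopy

variable {X : Type*} [TopologicalSpace X]

theorem FreelyHomotopic.trans {x y z : X} {σ : Path x x} {τ : Path y y} {ρ : Path z z}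
    (h : FreelyHomotopic σ τ) (h' : FreelyHomotopic τ ρ) : FreelyHomotopic σ ρ :=
  ContinuousMap.HomotopicWith.trans h h'

theorem freelyHomotopic_of_homotopic {x : X} {σ τ : Path x x} (h : σ.Homotopic τ) :
    FreelyHomotopic σ τ := by
  obtain ⟨H⟩ := h
  refine ⟨⟨H.toHomotopy, fun t ↦ ?_⟩⟩
  exact (H.source t).trans (H.target t).symm

/-- Slide the base point along `k`, at time `s` using only the tail of `k` from `k s` to `y`. -/
theorem freelyHomotopic_conj {x y : X} (k : Path x y) (τ : Path y y) :
    FreelyHomotopic (k.trans (τ.trans k.symm)) τ := by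
  let a (s : unitInterval) : Path (k s) y := (k.subpath s 1).cast rfl k.target.symm
  have ha : Continuous ↿a :=
    k.subpath_continuous_family.comp
      (continuous_fst.prodMk (continuous_const.prodMk continuous_snd))
  have hτ : Continuous ↿(fun _ : unitInterval ↦ τ) := τ.continuous.comp continuous_snd
  let F (s : unitInterval) : Path (k s) (k s) := (a s).trans (τ.trans (a s).symm)
  have hF : Continuous ↿F :=
    Path.trans_continuous_family _ ha _
      (Path.trans_continuous_family _ hτ _ (Path.symm_continuous_family _ ha))
  have h0 : ∀ t, F 0 t = (k.trans (τ.trans k.symm)) t := by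
    intro t
    simp [F, a, Path.trans_apply, Path.symm_apply]
  have h1 : ∀ t, F 1 t = ((Path.refl y).trans (τ.trans (Path.refl y).symm)) t := by
    intro t
    simp [F, a, Path.trans_apply, Path.symm_apply]
  have h : FreelyHomotopic (k.trans (τ.trans k.symm))
      ((Path.refl y).trans (τ.trans (Path.refl y).symm)) :=
    ⟨{ toFun := ↿F
       continuous_toFun := hF
       map_zero_left := h0
       map_one_left := h1
       prop' := fun s ↦ (F s).source.trans (F s).target.symm }⟩
  refine h.trans (freelyHomotopic_of_homotopic ?_)
  rw [← Homotopic.Quotient.eq]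
  simp

theorem freelyHomotopic_iff {x y : X} {σ : Path x x} {τ : Path y y} :
    FreelyHomotopic σ τ ↔ ∃ c : Homotopic.Quotient x y,
      Homotopic.Quotient.mk σ = c.trans ((Homotopic.Quotient.mk τ).trans c.symm) := by
  constructor
  · rintro ⟨H⟩
    have h := Path.Homotopic.map_trans_evalAt H.toHomotopy (Path.id)
    have e1 : σ.toContinuousMap 0 = x := σ.source
    have e2 : τ.toContinuousMap 0 = y := τ.source
    have e3 : σ.toContinuousMap 1 = x := σ.target
    have e4 : τ.toContinuousMap 1 = y := τ.target
    -- The conjugating path is the track of the base point under the free homotopy; the tracks of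
    -- both end points agree because every stage is a loop.
    let k : Path x y := (H.toHomotopy.evalAt 0).cast e1.symm e2.symm
    refine ⟨Homotopic.Quotient.mk k, ?_⟩
    have h' := h.pathCast e1.symm e4.symm
    have hl : (((Path.id).map (map_continuous σ.toContinuousMap)).trans
        (H.toHomotopy.evalAt 1)).cast e1.symm e4.symm = σ.trans k := by
      ext t
      simp only [Path.cast_coe, Path.trans_apply]
      split_ifs
      · rfl
      · exact (H.prop _).symm
    have hr : ((H.toHomotopy.evalAt 0).trans
        ((Path.id).map (map_continuous τ.toContinuousMap))).cast e1.symm e4.symm = k.trans τ := by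
      ext t
      simp only [Path.cast_coe, Path.trans_apply]
      split_ifs <;> rfl
    rw [hl, hr, ← Homotopic.Quotient.eq] at h'
    rw [Homotopic.Quotient.mk_trans, Homotopic.Quotient.mk_trans] at h'
    rw [← Homotopic.Quotient.trans_assoc, ← h', Homotopic.Quotient.trans_assoc, Homotopic.Quotient.trans_symm,
      Homotopic.Quotient.trans_refl]
  · rintro ⟨c, hc⟩
    obtain ⟨k, rfl⟩ := Homotopic.Quotient.mk_surjective c
    rw [← Homotopic.Quotient.mk_symm, ← Homotopic.Quotient.mk_trans, ← Homotopic.Quotient.mk_trans, Homotopic.Quotient.eq] at hc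
    exact (freelyHomotopic_of_homotopic hc).trans (freelyHomotopic_conj k τ)

end FreeHomotopy

/-! ### Evenly covered sets and locally constant sheet labels -/

section Trivial

variable {X Y : Type*} [TopologicalSpace X] [TopologicalSpace Y] {p : Y → X} {Z : Set X}

/-- The sheets are the level sets of `T`: open since `T` is locally constant, and homeomorphic to
`Z` because an open continuous bijection is a homeomorphism. -/
theorem isTrivialOver_of_isLocallyConstant (hp : IsLocalHomeomorph p) {F : Type*}
    (T : p ⁻¹' Z → F) (hT : IsLocallyConstant T)
    (hb : ∀ x ∈ Z, ∀ f, ∃! y : p ⁻¹' Z, p y = x ∧ T y = f) : IsTrivialOver p Z := by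
  refine ⟨Set.range fun f ↦ T ⁻¹' {f}, ?_, ?_, ?_, ?_⟩
  · rintro _ ⟨f, rfl⟩
    exact hT.isOpen_fiber f
  · rintro _ ⟨f, rfl⟩ _ ⟨g, rfl⟩ hfg
    refine Set.disjoint_left.2 fun y hy hy' ↦ hfg ?_
    rw [show f = g from hy.symm.trans hy']
  · exact Set.eq_univ_of_forall fun y ↦ ⟨_, ⟨T y, rfl⟩, rfl⟩
  · rintro _ ⟨f, rfl⟩
    refine ⟨?_, ?_, ?_, ?_⟩
    · exact (hp.continuous.restrictPreimage).comp continuous_subtype_val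
    · exact (hp.isOpenMap.restrictPreimage Z).comp (hT.isOpen_fiber f).isOpenMap_subtype_val
    · rintro ⟨y, hy⟩ ⟨y', hy'⟩ h
      have h' : p y = p y' := congrArg Subtype.val h
      exact Subtype.ext ((hb (p y') y'.2 f).unique ⟨h', hy⟩ ⟨rfl, hy'⟩)
    · rintro ⟨x, hx⟩
      obtain ⟨y, ⟨h1, h2⟩, -⟩ := hb x hx f
      exact ⟨⟨y, h2⟩, Subtype.ext h1⟩

theorem IsTrivialOver.exists_isLocallyConstant (h : IsTrivialOver p Z) :
    ∃ (S : Set (Set (p ⁻¹' Z))) (T : p ⁻¹' Z → S), IsLocallyConstant T ∧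
      ∀ x ∈ Z, ∀ f, ∃! y : p ⁻¹' Z, p y = x ∧ T y = f := by
  obtain ⟨S, ho, hd, hu, hh⟩ := h
  have hex : ∀ y, ∃ V : S, y ∈ V.1 := fun y ↦ by
    obtain ⟨V, hV, hy⟩ := hu.ge (Set.mem_univ y)
    exact ⟨⟨V, hV⟩, hy⟩
  choose T hT using hex
  have hTeq : ∀ (V : S) y, y ∈ V.1 → T y = V := fun V y hy ↦ by
    by_contra hne
    exact Set.disjoint_left.1 (hd (T y).2 V.2 fun h ↦ hne (Subtype.ext h)) (hT y) hy
  refine ⟨S, T, (IsLocallyConstant.iff_exists_open T).2 fun y ↦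
    ⟨(T y).1, ho _ (T y).2, hT y, fun y' hy' ↦ hTeq _ _ hy'⟩, fun x hx V ↦ ?_⟩
  have hb := (hh V.1 V.2).bijective
  obtain ⟨y, hy⟩ := hb.2 ⟨x, hx⟩
  refine ⟨y, ⟨congrArg Subtype.val hy, hTeq V _ y.2⟩, ?_⟩
  rintro y' ⟨h1, rfl⟩
  have : (⟨y', hT y'⟩ : (T y').1) = y :=
    hb.1 ((Subtype.ext (h1 : ((Z.restrictPreimage p y') : X) = x)).trans hy.symm)
  exact congrArg Subtype.val this

theorem IsTrivialOver.mono {Z' : Set X} (h : IsTrivialOver p Z) (hp : IsLocalHomeomorph p)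
    (hs : Z' ⊆ Z) : IsTrivialOver p Z' := by
  obtain ⟨S, T, hT, hb⟩ := h.exists_isLocallyConstant
  refine isTrivialOver_of_isLocallyConstant hp
    (T ∘ Set.inclusion (Set.preimage_mono hs)) (hT.comp_continuous (continuous_inclusion _)) ?_
  intro x hx f
  obtain ⟨y, ⟨hy, hf⟩, hu⟩ := hb x (hs hx) f
  refine ⟨⟨y, by rw [Set.mem_preimage, hy]; exact hx⟩, ⟨hy, hf⟩, ?_⟩
  rintro y' ⟨h1, h2⟩
  exact Subtype.ext (congrArg Subtype.val (hu _ ⟨h1, h2⟩) :)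

theorem isTrivialOver_baseSet {F : Type*} [TopologicalSpace F] [DiscreteTopology F]
    (hp : IsLocalHomeomorph p) (e : Bundle.Trivialization F p) : IsTrivialOver p e.baseSet := by
  refine isTrivialOver_of_isLocallyConstant hp (fun y ↦ (e y).2) ?_ ?_
  · rw [IsLocallyConstant.iff_continuous]
    refine continuous_snd.comp (e.continuousOn_toFun.comp_continuous continuous_subtype_val ?_)
    intro y
    rw [e.source_eq]
    exact y.2
  · intro x hx f
    have hm : (x, f) ∈ e.target := e.mem_target.2 hx
    refine ⟨⟨e.toOpenPartialHomeomorph.symm (x, f), ?_⟩, ⟨e.proj_symm_apply hm, ?_⟩, ?_⟩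
    · rw [Set.mem_preimage, e.proj_symm_apply hm]
      exact hx
    · simp [e.apply_symm_apply hm]
    · rintro ⟨y, hy⟩ ⟨rfl, rfl⟩
      have hy' : y ∈ e.source := e.mem_source.2 hy
      refine Subtype.ext ?_
      simp only
      rw [e.mk_proj_snd hy']
      exact (e.left_inv hy').symm

theorem _root_.IsCoveringMap.exists_isTrivialOver (hp : IsCoveringMap p) (x : X) :
    ∃ U, IsOpen U ∧ x ∈ U ∧ IsTrivialOver p U := by
  have h := hp x
  by_cases hne : Nonempty (p ⁻¹' {x})
  · have := h.1
    exact ⟨_, h.toTrivialization.open_baseSet, h.mem_toTrivialization_baseSet,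
      isTrivialOver_baseSet hp.isLocalHomeomorph _⟩
  -- Covering maps need not be surjective: over an empty fibre the label set is empty.
  · obtain ⟨-, U, hxU, hU, -, H, hH⟩ := h
    refine ⟨U, hU, hxU, isTrivialOver_of_isLocallyConstant (F := Empty) hp.isLocalHomeomorph
      (fun y ↦ (hne ⟨(H y).2⟩).elim) ?_ ?_⟩
    · exact (IsLocallyConstant.iff_exists_open _).2 fun y ↦ (hne ⟨(H y).2⟩).elim
    · exact fun _ _ f ↦ f.elim

/-- A loop inside a set over which a covering map is trivial has trivial monodromy. -/
theorem IsTrivialOver.monodromy_eq (h : IsTrivialOver p Z) (hp : IsCoveringMap p) {x : X}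
    (a : Path x x) (ha : ∀ t, a t ∈ Z) (e : p ⁻¹' {x}) : hp.monodromy (Homotopic.Quotient.mk a) e = e := by
  obtain ⟨S, T, hT, hb⟩ := h.exists_isLocallyConstant
  let Γ := hp.liftPath a e (a.source.trans e.2.symm)
  have hΓ : ∀ t, p (Γ t) = a t := fun t ↦ congrFun (hp.liftPath_lifts a e _) t
  have hΓ0 : Γ 0 = e := hp.liftPath_zero a e _
  let Γ' : unitInterval → p ⁻¹' Z := fun t ↦ ⟨Γ t, by rw [Set.mem_preimage, hΓ]; exact ha t⟩
  have hΓ' : Continuous Γ' := Γ.continuous.subtype_mk _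
  have hc : T (Γ' 1) = T (Γ' 0) := (hT.comp_continuous hΓ').apply_eq_of_isPreconnected
    isPreconnected_univ (Set.mem_univ 1) (Set.mem_univ 0)
  have hx : x ∈ Z := by simpa using ha 0
  have h1 : p (Γ' 1) = x := (hΓ 1).trans a.target
  have h0 : p (Γ' 0) = x := (hΓ 0).trans a.source
  have := (hb x hx _).unique ⟨h1, hc⟩ ⟨h0, rfl⟩
  exact Subtype.ext ((congrArg Subtype.val this).trans hΓ0)

end Trivial

/-! ### Homotopy classes of short paths -/

section Short

variable {E : Type*} [NormedAddCommGroup E] [NormedSpace ℝ E] {H : Type*} [TopologicalSpace H]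
  (I : ModelWithCorners ℝ E H) {M : Type*} [PseudoEMetricSpace M] [ChartedSpace H M]
  [Bundle.RiemannianBundle (fun x : M ↦ TangentSpace I x)]

/-- A homotopy class of paths is `r`-short if it contains a path of length less than `r` which is
`C^1` and constant near its end points. -/
def IsShort {x y : M} (r : ℝ≥0∞) (q : Homotopic.Quotient x y) : Prop :=
  ∃ a : Path x y, Homotopic.Quotient.mk a = q ∧ ContMDiff 𝓘(ℝ) I 1 a.extend ∧
    a.extend =ᶠ[𝓝 0] (fun _ ↦ x) ∧ a.extend =ᶠ[𝓝 1] (fun _ ↦ y) ∧ pathELength I a.extend 0 1 < r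

variable {I} {x y z : M} {r r' : ℝ≥0∞}

theorem IsShort.mono {q : Homotopic.Quotient x y} (h : IsShort I r q) (hr : r ≤ r') :
    IsShort I r' q := by
  obtain ⟨a, h1, h2, h3, h4, h5⟩ := h
  exact ⟨a, h1, h2, h3, h4, h5.trans_le hr⟩

theorem IsShort.exists_lt {q : Homotopic.Quotient x y} (h : IsShort I r q) :
    ∃ r' < r, IsShort I r' q := by
  obtain ⟨a, h1, h2, h3, h4, h5⟩ := h
  obtain ⟨r', hr, hr'⟩ := exists_between h5
  exact ⟨r', hr', a, h1, h2, h3, h4, hr⟩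

/-- Being constant near the end points is what keeps the concatenation `C^1` at the junction. -/
theorem IsShort.trans {q : Homotopic.Quotient x y} {q' : Homotopic.Quotient y z}
    (h : IsShort I r q) (h' : IsShort I r' q') : IsShort I (r + r') (q.trans q') := by
  obtain ⟨a, rfl, a2, a3, a4, a5⟩ := h
  obtain ⟨b, rfl, b2, b3, b4, b5⟩ := h'
  have hfd : ContMDiff 𝓘(ℝ) 𝓘(ℝ) 1 (fun t : ℝ ↦ 2 * t) :=
    contMDiff_iff_contDiff.2 (by fun_prop)
  have hgd : ContMDiff 𝓘(ℝ) 𝓘(ℝ) 1 (fun t : ℝ ↦ 2 * t - 1) :=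
    contMDiff_iff_contDiff.2 (by fun_prop)
  have heq : ⇑(a.trans b).extend = Set.piecewise (Set.Iic (1 / 2 : ℝ))
      (a.extend ∘ fun t ↦ 2 * t) (b.extend ∘ fun t ↦ 2 * t - 1) := by
    ext t
    by_cases ht : t ≤ 1 / 2
    · rw [Set.piecewise_eq_of_mem (Set.Iic (1 / 2 : ℝ)) _ _ ht, Path.extend_trans_of_le_half _ _ ht]
      rfl
    · rw [Set.piecewise_eq_of_notMem (Set.Iic (1 / 2 : ℝ)) _ _ ht, Path.extend_trans_of_half_le _ _ (not_le.1 ht).le]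
      rfl
  refine ⟨a.trans b, Homotopic.Quotient.mk_trans a b, ?_, ?_, ?_, ?_⟩
  · rw [heq]
    refine ContMDiff.piecewise_Iic (a2.comp hfd) (b2.comp hgd) ?_
    have t1 : Filter.Tendsto (fun t : ℝ ↦ 2 * t) (𝓝 (1 / 2)) (𝓝 1) := by
      have : Continuous (fun t : ℝ ↦ 2 * t) := by fun_prop
      convert this.tendsto (1 / 2) using 2
      norm_num
    have t2 : Filter.Tendsto (fun t : ℝ ↦ 2 * t - 1) (𝓝 (1 / 2)) (𝓝 0) := by
      have : Continuous (fun t : ℝ ↦ 2 * t - 1) := by fun_prop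
      convert this.tendsto (1 / 2) using 2
      norm_num
    filter_upwards [t1.eventually a4, t2.eventually b3] with t h1 h2
    exact h1.trans h2.symm
  · have t1 : Filter.Tendsto (fun t : ℝ ↦ 2 * t) (𝓝 0) (𝓝 0) := by
      have : Continuous (fun t : ℝ ↦ 2 * t) := by fun_prop
      convert this.tendsto 0 using 2
      norm_num
    filter_upwards [t1.eventually a3, Iio_mem_nhds (show (0 : ℝ) < 1 / 2 by norm_num)] with t h1 h2
    rw [Path.extend_trans_of_le_half _ _ (le_of_lt h2)]
    exact h1
  · have t1 : Filter.Tendsto (fun t : ℝ ↦ 2 * t - 1) (𝓝 1) (𝓝 1) := by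
      have : Continuous (fun t : ℝ ↦ 2 * t - 1) := by fun_prop
      convert this.tendsto 1 using 2
      norm_num
    filter_upwards [t1.eventually b4, Ioi_mem_nhds (show (1 / 2 : ℝ) < 1 by norm_num)] with t h1 h2
    rw [Path.extend_trans_of_half_le _ _ (le_of_lt h2)]
    exact h1
  · rw [← pathELength_add (b := 1 / 2) (by norm_num) (by norm_num)]
    refine ENNReal.add_lt_add ?_ ?_
    · rw [pathELength_congr (γ' := a.extend ∘ fun t ↦ 2 * t)
        fun t ht ↦ Path.extend_trans_of_le_half _ _ ht.2,
        pathELength_comp_of_monotoneOn (by norm_num) (fun s _ t _ h ↦ by simpa using h)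
          (by fun_prop) (a2.mdifferentiable one_ne_zero).mdifferentiableOn]
      simpa using a5
    · rw [pathELength_congr (γ' := b.extend ∘ fun t ↦ 2 * t - 1)
        fun t ht ↦ Path.extend_trans_of_half_le _ _ ht.1,
        pathELength_comp_of_monotoneOn (by norm_num) (fun s _ t _ h ↦ by simpa using h)
          (by fun_prop) (b2.mdifferentiable one_ne_zero).mdifferentiableOn]
      convert b5 using 2 <;> norm_num

theorem IsShort.symm {q : Homotopic.Quotient x y} (h : IsShort I r q) : IsShort I r q.symm := by
  obtain ⟨a, rfl, a2, a3, a4, a5⟩ := h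
  have hc : Continuous (fun t : ℝ ↦ 1 - t) := by fun_prop
  have heq : ⇑a.symm.extend = a.extend ∘ fun t ↦ 1 - t := a.extend_symm
  refine ⟨a.symm, Homotopic.Quotient.mk_symm a, ?_, ?_, ?_, ?_⟩
  · rw [heq]
    exact a2.comp (contMDiff_iff_contDiff.2 (by fun_prop))
  · rw [heq]
    exact (show Filter.Tendsto (fun t : ℝ ↦ 1 - t) (𝓝 0) (𝓝 1) by
      simpa using hc.tendsto 0).eventually a4
  · rw [heq]
    exact (show Filter.Tendsto (fun t : ℝ ↦ 1 - t) (𝓝 1) (𝓝 0) by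
      simpa using hc.tendsto 1).eventually a3
  · rw [heq, pathELength_comp_of_antitoneOn zero_le_one (fun s _ t _ h ↦ sub_le_sub_left h 1)
          (by fun_prop) (a2.mdifferentiable one_ne_zero).mdifferentiableOn]
    simpa using a5

theorem isShort_mk (a : Path x y) (ha : ContMDiffOn 𝓘(ℝ) I 1 a.extend (Set.Icc 0 1))
    (hr : pathELength I a.extend 0 1 < r) : IsShort I r (Homotopic.Quotient.mk a) := by
  -- A monotone smooth reparametrisation, constant on both outer thirds, preserves the length and
  -- the homotopy class.
  let η (t : ℝ) : ℝ := Real.smoothTransition (3 * t - 1)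
  have h0 (t) (ht : t < 1 / 3) : η t = 0 := Real.smoothTransition.zero_of_nonpos (by linarith)
  have h1 (t) (ht : 2 / 3 < t) : η t = 1 := Real.smoothTransition.one_of_one_le (by linarith)
  have hη : ContDiff ℝ 1 η := by fun_prop
  have hm (t) : η t ∈ Set.Icc (0 : ℝ) 1 :=
    ⟨Real.smoothTransition.nonneg _, Real.smoothTransition.le_one _⟩
  let f (t : unitInterval) : unitInterval := ⟨η t, hm t⟩
  have hf : Continuous f := (hη.continuous.comp continuous_subtype_val).subtype_mk _
  have hf0 : f 0 = 0 := Subtype.ext (h0 _ (by norm_num))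
  have hf1 : f 1 = 1 := Subtype.ext (h1 _ (by norm_num))
  have heq : ⇑(a.reparam f hf hf0 hf1).extend = a.extend ∘ η := by
    ext t
    rw [Function.comp_apply]
    rcases le_total t 0 with ht | ht
    · rw [Path.extend_of_le_zero _ ht, h0 _ (by linarith), Path.extend_zero]
    rcases le_total 1 t with ht' | ht'
    · rw [Path.extend_of_one_le _ ht', h1 _ (by linarith), Path.extend_one]
    rw [Path.extend_apply _ ⟨ht, ht'⟩, Path.extend_apply _ (hm t)]
    rfl
  refine ⟨a.reparam f hf hf0 hf1,
    Homotopic.Quotient.eq.2 ⟨(Path.Homotopy.reparam a f hf hf0 hf1).symm⟩, ?_, ?_, ?_, ?_⟩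
  · rw [heq, ← contMDiffOn_univ]
    exact ha.comp (contMDiffOn_univ.2 (contMDiff_iff_contDiff.2 hη)) fun t _ ↦ hm t
  · filter_upwards [Iio_mem_nhds (show (0 : ℝ) < 1 / 3 by norm_num)] with t ht
    rw [heq, Function.comp_apply, h0 t ht, Path.extend_zero]
  · filter_upwards [Ioi_mem_nhds (show (2 / 3 : ℝ) < 1 by norm_num)] with t ht
    rw [heq, Function.comp_apply, h1 t ht, Path.extend_one]
  · have e0 : η 0 = 0 := h0 _ (by norm_num)
    have e1 : η 1 = 1 := h1 _ (by norm_num)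
    rw [heq, pathELength_comp_of_monotoneOn zero_le_one _ (hη.differentiable one_ne_zero).differentiableOn,
      e0, e1]
    · exact hr
    · rw [e0, e1]
      exact ha.mdifferentiableOn one_ne_zero
    · exact (Real.smoothTransition.monotone.comp fun s t h ↦ by simpa using h).monotoneOn _

/-- Small segments of a `C^1` path of finite length are short. -/
theorem eventually_isShort_subpath (a : Path x y) (ha : ContMDiff 𝓘(ℝ) I 1 a.extend)
    (hfin : pathELength I a.extend 0 1 ≠ ⊤) (t₀ : unitInterval) (hr : r ≠ 0) :
    ∀ᶠ t in 𝓝 t₀, IsShort I r (Homotopic.Quotient.mk (a.subpath t₀ t)) := by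
  rw [pathELength_eq_lintegral_mfderiv_Icc] at hfin
  -- Absolute continuity of the integral of the speed.
  obtain ⟨δ, hδ, hsmall⟩ := MeasureTheory.exists_pos_setLIntegral_lt_of_measure_lt hfin hr
  have key : ∀ s t : unitInterval, s ≤ t → ENNReal.ofReal ((t : ℝ) - s) < δ →
      IsShort I r (Homotopic.Quotient.mk (a.subpath s t)) := by
    intro s t hst hlt
    let η (u : ℝ) : ℝ := (1 - u) * s + u * t
    have hη : ContDiff ℝ 1 η := by fun_prop
    have heq : Set.EqOn (a.subpath s t).extend (a.extend ∘ η) (Set.Icc 0 1) := by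
      intro u hu
      have hm : η u ∈ Set.Icc (0 : ℝ) 1 := (Set.Icc.convexComb s t ⟨u, hu⟩).2
      rw [Path.extend_apply _ hu, Function.comp_apply, Path.extend_apply _ hm]
      rfl
    have e0 : η 0 = s := by simp [η]
    have e1 : η 1 = t := by simp [η]
    refine isShort_mk _ ?_ ?_
    · exact ContMDiffOn.congr (ha.comp (contMDiff_iff_contDiff.2 hη)).contMDiffOn heq
    · rw [pathELength_congr heq, pathELength_comp_of_monotoneOn zero_le_one _
        (hη.differentiable one_ne_zero).differentiableOn
        (ha.mdifferentiable one_ne_zero).mdifferentiableOn, e0, e1,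
        pathELength_eq_lintegral_mfderiv_Icc]
      · have hsub : Set.Icc (s : ℝ) t ⊆ Set.Icc 0 1 := Set.Icc_subset_Icc s.2.1 t.2.2
        have := hsmall (Set.Icc (s : ℝ) t) (by
          rw [MeasureTheory.Measure.restrict_apply measurableSet_Icc,
            Set.inter_eq_left.2 hsub, Real.volume_Icc]
          exact hlt)
        rwa [MeasureTheory.Measure.restrict_restrict measurableSet_Icc,
          Set.inter_eq_left.2 hsub] at this
      · intro u _ v _ huv
        have : (s : ℝ) ≤ t := hst
        simp only [η]
        nlinarith
  have hlim : Filter.Tendsto (fun t : unitInterval ↦ ENNReal.ofReal |(t : ℝ) - t₀|) (𝓝 t₀)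
      (𝓝 0) := by
    have : Continuous (fun t : unitInterval ↦ ENNReal.ofReal |(t : ℝ) - t₀|) :=
      ENNReal.continuous_ofReal.comp (by fun_prop)
    simpa using this.tendsto t₀
  filter_upwards [hlim.eventually (gt_mem_nhds hδ)] with t ht
  rcases le_total t₀ t with h | h
  · exact key t₀ t h ((ENNReal.ofReal_le_ofReal (le_abs_self _)).trans_lt ht)
  · rw [← Path.symm_subpath, Homotopic.Quotient.mk_symm]
    refine (key t t₀ h ((ENNReal.ofReal_le_ofReal ?_).trans_lt ht)).symm
    rw [abs_sub_comm]
    exact le_abs_self _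

variable [IsRiemannianManifold I M]

theorem exists_isShort (h : edist x y < r) : ∃ q : Homotopic.Quotient x y, IsShort I r q := by
  rw [IsRiemannianManifold.out (I := I) x y] at h
  obtain ⟨γ, rfl, rfl, h1, h2⟩ := exists_lt_of_riemannianEDist_lt h
  let a : Path (γ 0) (γ 1) :=
    ⟨⟨fun t : unitInterval ↦ γ t, h1.continuousOn.domRestrict⟩, rfl, rfl⟩
  have heq : Set.EqOn a.extend γ (Set.Icc 0 1) := fun t ht ↦ Path.extend_apply a ht
  exact ⟨Homotopic.Quotient.mk a, isShort_mk a (h1.congr heq) (by rwa [pathELength_congr heq])⟩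

theorem edist_add_edist_le_pathELength {a : Path x y} (ha : ContMDiff 𝓘(ℝ) I 1 a.extend)
    (t : unitInterval) : edist x (a t) + edist (a t) y ≤ pathELength I a.extend 0 1 := by
  rw [← pathELength_add t.2.1 t.2.2, IsRiemannianManifold.out (I := I),
    IsRiemannianManifold.out (I := I)]
  exact add_le_add
    (riemannianEDist_le_pathELength ha.contMDiffOn a.extend_zero (a.extend_extends' t) t.2.1)
    (riemannianEDist_le_pathELength ha.contMDiffOn (a.extend_extends' t) a.extend_one t.2.2)

theorem IsShort.exists_path_mem_eball {q : Homotopic.Quotient x y} (h : IsShort I r q) :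
    ∃ a : Path x y, Homotopic.Quotient.mk a = q ∧ ∀ t, a t ∈ Metric.eball x r := by
  obtain ⟨a, h1, h2, -, -, h5⟩ := h
  refine ⟨a, h1, fun t ↦ ?_⟩
  rw [Metric.mem_eball, edist_comm]
  exact (le_self_add.trans (edist_add_edist_le_pathELength h2 t)).trans_lt h5

/-- A point of the loop cuts it into two arcs, each at least as long as its distance to `x`; this is
the source of the factor `1/2` in the theorem. -/
theorem IsShort.exists_loop_mem_eball {q : Homotopic.Quotient x x} (h : IsShort I (2 * r) q) :
    ∃ a : Path x x, Homotopic.Quotient.mk a = q ∧ ∀ t, a t ∈ Metric.eball x r := by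
  obtain ⟨a, h1, h2, -, -, h5⟩ := h
  refine ⟨a, h1, fun t ↦ ?_⟩
  have := (edist_add_edist_le_pathELength h2 t).trans_lt h5
  rw [edist_comm x, ← two_mul] at this
  rw [Metric.mem_eball]
  exact lt_of_mul_lt_mul_left' this

end Short

/-! ### Marked length through short loops -/

section MinMarkedLength

variable {n : ℕ} {M : Type*} [PseudoEMetricSpace M] [ChartedSpace (EuclideanSpace ℝ (Fin n)) M]
    [Bundle.RiemannianBundle (fun x : M ↦ TangentSpace (𝓡 n) x)] {x₀ : M} {r : ℝ≥0∞}

theorem minMarkedLength_lt_iff {γ : FundamentalGroup M x₀} :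
    minMarkedLength (n := n) γ < r ↔ ∃ (y : M) (c : Homotopic.Quotient x₀ y)
      (q : Homotopic.Quotient y y), IsShort (𝓡 n) r q ∧
        γ = FundamentalGroup.fromPath (c.trans (q.trans c.symm)) := by
  rw [minMarkedLength, sInf_lt_iff]
  constructor
  · rintro ⟨L, ⟨σ, y, τ, rfl, hστ, hτ, rfl⟩, hL⟩
    obtain ⟨c, hc⟩ := freelyHomotopic_iff.1 hστ
    exact ⟨y, c, _, isShort_mk τ hτ hL, congrArg FundamentalGroup.fromPath hc⟩
  · rintro ⟨y, c, q, ⟨τ, rfl, h2, -, -, h5⟩, rfl⟩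
    obtain ⟨σ, hσ⟩ := Homotopic.Quotient.mk_surjective
      (c.trans ((Homotopic.Quotient.mk τ).trans c.symm))
    exact ⟨_, ⟨σ, y, τ, congrArg FundamentalGroup.fromPath hσ, freelyHomotopic_iff.2 ⟨c, hσ⟩,
      h2.contMDiffOn, rfl⟩, h5⟩

end MinMarkedLength

/-! ### Triviality over balls versus monodromy of short loops -/

section Short

variable {E : Type*} [NormedAddCommGroup E] [NormedSpace ℝ E] {H : Type*} [TopologicalSpace H]
  {I : ModelWithCorners ℝ E H} {M : Type*} [PseudoEMetricSpace M] [ChartedSpace H M]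
  [Bundle.RiemannianBundle (fun x : M ↦ TangentSpace I x)] [IsRiemannianManifold I M]

/-- If the monodromy of a covering space along all loops of length less than `2δ` is trivial, then
the covering space is trivial over all balls of radius `δ`. -/
theorem isTrivialOver_eball {Y : Type*} [TopologicalSpace Y] {p : Y → M} (hp : IsCoveringMap p)
    {δ : ℝ≥0∞} (h : ∀ (y : M) (q : Homotopic.Quotient y y), IsShort I (2 * δ) q →
      ∀ e, hp.monodromy q e = e) (x : M) : IsTrivialOver p (Metric.eball x δ) := by
  have hs : ∀ z ∈ Metric.eball x δ, ∃ q : Homotopic.Quotient x z, IsShort I δ q := fun z hz ↦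
    exists_isShort (by rwa [Metric.mem_eball, edist_comm] at hz)
  choose s hs using hs
  let T (z : p ⁻¹' Metric.eball x δ) : p ⁻¹' {x} := hp.monodromy (s (p z) z.2).symm ⟨z, rfl⟩
  have hT : ∀ y (hy : y ∈ Metric.eball x δ) (e : p ⁻¹' {y}) (he : p e ∈ Metric.eball x δ),
      T ⟨e, he⟩ = hp.monodromy (s y hy).symm e := by
    rintro _ hy ⟨e, rfl⟩ he
    rfl
  refine isTrivialOver_of_isLocallyConstant hp.isLocalHomeomorph T ?_ ?_
  · refine (IsLocallyConstant.iff_eventually_eq T).2 fun z₀ ↦ ?_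
    obtain ⟨e, he, hpe⟩ := hp.isLocalHomeomorph z₀
    have hpe' : ∀ u, p u = e u := congrFun hpe
    obtain ⟨r, hr, hsr⟩ := (hs (p z₀) z₀.2).exists_lt
    have hpz : p z₀ ∈ e.target := (hpe' z₀).symm ▸ e.map_source he
    obtain ⟨η', hη', hsub⟩ := EMetric.mem_nhds_iff.1 (e.open_target.mem_nhds hpz)
    -- `η'` keeps short paths from `p z₀` inside the image of a local section; `δ - r` is the slack
    -- needed to close a loop shorter than `2δ`.
    let η := min η' (δ - r)
    have hη : 0 < η := lt_min hη' (tsub_pos_of_lt hr)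
    have hev : ∀ᶠ z : Y in 𝓝 z₀, z ∈ e.source ∧ p z ∈ Metric.eball (p z₀) η :=
      (e.open_source.eventually_mem he).and
        (hp.continuous.continuousAt.eventually_mem (Metric.eball_mem_nhds _ hη))
    filter_upwards [continuous_subtype_val.continuousAt.eventually hev] with z ⟨hz, hzη⟩
    obtain ⟨w, hw⟩ := exists_isShort (I := I) (by rwa [Metric.mem_eball, edist_comm] at hzη)
    obtain ⟨a, ha, hmem⟩ := hw.exists_path_mem_eball
    have hmem' : ∀ t, a t ∈ e.target := fun t ↦
      hsub (Metric.eball_subset_eball (min_le_left _ _) (hmem t))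
    have hl : ∀ u ∈ e.source, e.symm (p u) = u := fun u hu ↦ by
      rw [hpe']
      exact e.left_inv hu
    let Γ : Path z₀.1 z.1 := (a.map' (e.continuousOn_symm.mono (by
      rintro _ ⟨t, rfl⟩
      exact hmem' t))).cast (hl _ he).symm (hl _ hz).symm
    have hΓ : (Homotopic.Quotient.mk Γ).map ⟨p, hp.continuous⟩ = w := by
      rw [← ha, ← Homotopic.Quotient.mk_map]
      congr 1
      ext t
      exact (hpe' _).trans (e.right_inv (hmem' t))
    have hw' : hp.monodromy w ⟨z₀, rfl⟩ = ⟨z, rfl⟩ := by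
      rw [← hΓ]
      exact hp.monodromy_map _
    change hp.monodromy _ _ = hp.monodromy _ _
    -- The triangle `x → p z₀ → p z → x` is shorter than `r + η + δ ≤ 2δ`, so both routes back to
    -- `x` give the same label.
    have hloop := h x ((s (p z₀) z₀.2).trans (w.trans (s (p z) z.2).symm))
      ((hsr.trans (hw.trans (hs (p z) z.2).symm)).mono (by
        rw [← add_assoc, two_mul]
        gcongr
        calc r + η ≤ r + (δ - r) := by gcongr; exact min_le_right _ _
          _ = δ := add_tsub_cancel_of_le hr.le))
      (hp.monodromy (s (p z₀) z₀.2).symm ⟨z₀, rfl⟩)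
    rw [← hloop, ← hp.monodromy_trans_apply, ← hw', ← hp.monodromy_trans_apply,
      ← Homotopic.Quotient.trans_assoc, Homotopic.Quotient.symm_trans,
      Homotopic.Quotient.refl_trans]
  · intro y hy f
    obtain ⟨hi, hsurj⟩ := hp.monodromy_bijective (s y hy).symm
    obtain ⟨e, rfl⟩ := hsurj f
    have he : p e = y := e.2
    refine ⟨⟨e, by rw [Set.mem_preimage, he]; exact hy⟩, ⟨he, hT _ _ _ _⟩, ?_⟩
    rintro ⟨z, hz⟩ ⟨hzy, hzT⟩
    rw [hT y hy ⟨z, hzy⟩] at hzT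
    exact Subtype.ext (congrArg Subtype.val (hi hzT) :)

theorem isTrivialOver_eball_iff {Y : Type*} [TopologicalSpace Y] {p : Y → M}
    (hp : IsCoveringMap p) {δ : ℝ≥0∞} :
    (∀ x, IsTrivialOver p (Metric.eball x δ)) ↔
      ∀ (y : M) (q : Homotopic.Quotient y y), IsShort I (2 * δ) q →
        ∀ e, hp.monodromy q e = e := by
  refine ⟨fun h y q hq e ↦ ?_, isTrivialOver_eball hp⟩
  obtain ⟨a, rfl, ha⟩ := hq.exists_loop_mem_eball
  exact (h y).monodromy_eq hp a ha e

end Short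

/-! ### Triviality over balls in terms of the length filtration -/

section Filtration

theorem two_mul_ofReal_half (t : ℝ) : 2 * ENNReal.ofReal (t / 2) = ENNReal.ofReal t := by
  rw [← ENNReal.ofReal_ofNat, ← ENNReal.ofReal_mul zero_le_two]
  congr 1
  ring

variable {n : ℕ} {M : Type*} [MetricSpace M] [ChartedSpace (EuclideanSpace ℝ (Fin n)) M]
    [Bundle.RiemannianBundle (fun x : M ↦ TangentSpace (𝓡 n) x)]
    [IsRiemannianManifold (𝓡 n) M]

/-- Trivial monodromy is insensitive to conjugation by a path, so short loops at all base points can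
be tested at `x₀`. -/
theorem isDeltaTrivial_iff {Y : Type*} [TopologicalSpace Y] {p : Y → M} (hp : IsCoveringMap p)
    (x₀ : M) (δ : ℝ) : IsDeltaTrivial p (ENNReal.ofReal (δ / 2)) ↔
      lengthFiltration (fun γ : FundamentalGroup M x₀ ↦ minMarkedLength (n := n) γ) δ ≤
        (hp.monodromyPerm x₀).ker := by
  rw [IsDeltaTrivial, isTrivialOver_eball_iff (I := 𝓡 n) hp, two_mul_ofReal_half, lengthFiltration,
    Subgroup.closure_le]
  constructor
  · intro h γ hγ
    obtain ⟨y, c, q, hq, rfl⟩ := minMarkedLength_lt_iff.1 hγ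
    refine Equiv.ext fun e ↦ ?_
    change hp.monodromy _ e = e
    rw [hp.monodromy_trans_apply, hp.monodromy_trans_apply, h y q hq, ← hp.monodromy_trans_apply,
      Homotopic.Quotient.trans_symm, hp.monodromy_refl, id]
  · intro h y q hq e
    obtain ⟨c, -⟩ := exists_isShort (I := 𝓡 n) (edist_lt_top x₀ y)
    have hγ : hp.monodromyPerm x₀ (FundamentalGroup.fromPath (c.trans (q.trans c.symm))) = 1 :=
      h (minMarkedLength_lt_iff.2 ⟨y, c, q, hq, rfl⟩)
    have h1 : hp.monodromy (c.trans (q.trans c.symm)) (hp.monodromy c.symm e) =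
      hp.monodromy c.symm e := DFunLike.congr_fun hγ _
    rw [← hp.monodromy_trans_apply, ← Homotopic.Quotient.trans_assoc,
      Homotopic.Quotient.symm_trans, Homotopic.Quotient.refl_trans,
      hp.monodromy_trans_apply] at h1
    exact (hp.monodromy_bijective c.symm).1 h1

end Filtration

/-! ### The covering glued from holonomies -/

section Holonomy

universe u

/-- A homomorphism from the fundamental groupoid of `X` to a group `G`. -/
structure Holonomy (X : Type*) [TopologicalSpace X] (G : Type*) [Group G] where
  /-- the value on a homotopy class of paths -/
  hol {x y : X} : Homotopic.Quotient x y → G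
  hol_trans {x y z : X} (q : Homotopic.Quotient x y) (q' : Homotopic.Quotient y z) :
    hol (q.trans q') = hol q' * hol q

namespace Holonomy

variable {X : Type*} [TopologicalSpace X] {G : Type*} [Group G] (h : Holonomy X G) {x y z : X}

theorem hol_refl (x : X) : h.hol (Homotopic.Quotient.refl x) = 1 := by
  have := h.hol_trans (Homotopic.Quotient.refl x) (Homotopic.Quotient.refl x)
  rw [Homotopic.Quotient.refl_trans] at this
  exact left_eq_mul.1 this

theorem hol_symm (q : Homotopic.Quotient x y) : h.hol q.symm = (h.hol q)⁻¹ := by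
  rw [eq_inv_iff_mul_eq_one, ← h.hol_trans, Homotopic.Quotient.trans_symm, h.hol_refl]

theorem hol_cast {x' y' : X} (q : Homotopic.Quotient x y) (hx : x' = x) (hy : y' = y) :
    h.hol (q.cast hx hy) = h.hol q := by
  subst hx hy
  simp

end Holonomy

variable {E : Type*} [NormedAddCommGroup E] [NormedSpace ℝ E] {H : Type*} [TopologicalSpace H]
  {I : ModelWithCorners ℝ E H} {M : Type*} [PseudoEMetricSpace M] [ChartedSpace H M]
  [Bundle.RiemannianBundle (fun x : M ↦ TangentSpace I x)]
  {G : Type*} [Group G] {h : Holonomy M G} {δ : ℝ≥0∞}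

theorem Holonomy.hol_eq_of_isShort
    (hδ : ∀ (y : M) (q : Homotopic.Quotient y y), IsShort I (2 * δ) q → h.hol q = 1)
    {y z : M} {q q' : Homotopic.Quotient y z} {r r' : ℝ≥0∞} (hq : IsShort I r q)
    (hq' : IsShort I r' q') (hr : r + r' ≤ 2 * δ) : h.hol q = h.hol q' := by
  have := hδ y _ ((hq.trans hq'.symm).mono hr)
  rw [h.hol_trans, h.hol_symm, inv_mul_eq_one] at this
  exact this.symm

variable [IsRiemannianManifold I M]

/-- For `z` near `z₀` the detour through `z₀` is still shorter than `δ`, so it has the holonomy of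
the chosen path. This is the local constancy of the transition functions. -/
theorem Holonomy.eventually_hol_eq
    (hδ : ∀ (y : M) (q : Homotopic.Quotient y y), IsShort I (2 * δ) q → h.hol q = 1)
    {s : ∀ y z : M, Homotopic.Quotient y z} (hs : ∀ y z, edist y z < δ → IsShort I δ (s y z))
    {y z₀ : M} (hy : edist y z₀ < δ) :
    ∀ᶠ z in 𝓝 z₀, h.hol (s y z) = h.hol (s z₀ z) * h.hol (s y z₀) := by
  obtain ⟨r, hr, hsr⟩ := (hs y z₀ hy).exists_lt
  have hη : 0 < δ - r := tsub_pos_of_lt hr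
  have hrη : r + (δ - r) = δ := add_tsub_cancel_of_le hr.le
  filter_upwards [Metric.eball_mem_nhds z₀ hη] with z hz
  rw [Metric.mem_eball, edist_comm] at hz
  obtain ⟨w, hw⟩ := exists_isShort (I := I) hz
  have hzδ : edist z₀ z < δ := hz.trans_le tsub_le_self
  have hyz : edist y z < δ := by
    obtain ⟨a, -, ha⟩ := (hsr.trans hw).exists_path_mem_eball
    have := ha 1
    rwa [a.target, hrη, Metric.mem_eball, edist_comm] at this
  rw [hol_eq_of_isShort hδ (hs z₀ z hzδ) hw (by rw [two_mul]; gcongr; exact tsub_le_self),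
    ← h.hol_trans]
  exact hol_eq_of_isShort hδ (hs y z hyz) (hsr.trans hw) (by rw [hrη, two_mul])

/-- The fibre bundle over `M` with structure group the discrete group `G` which is trivial over
balls of radius `δ`, glued by the holonomies of short paths. -/
def Holonomy.bundleCore [TopologicalSpace G] [DiscreteTopology G] (hδ0 : 0 < δ)
    (hδ : ∀ (y : M) (q : Homotopic.Quotient y y), IsShort I (2 * δ) q → h.hol q = 1)
    {s : ∀ y z : M, Homotopic.Quotient y z} (hs : ∀ y z, edist y z < δ → IsShort I δ (s y z)) :
    FiberBundleCore M M G where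
  baseSet y := Metric.eball y δ
  isOpen_baseSet _ := Metric.isOpen_eball
  indexAt := id
  mem_baseSet_at _ := Metric.mem_eball_self hδ0
  coordChange y y' z v := (h.hol (s y' z))⁻¹ * h.hol (s y z) * v
  coordChange_self y z _ v := by simp
  continuousOn_coordChange y y' := by
    rintro ⟨z₀, v₀⟩ ⟨⟨hy, hy'⟩, -⟩
    rw [Metric.mem_eball, edist_comm] at hy hy'
    refine ContinuousAt.continuousWithinAt ?_
    refine (continuousAt_const (y := (h.hol (s y' z₀))⁻¹ * h.hol (s y z₀) * v₀)).congr ?_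
    have hv : ∀ᶠ p : M × G in 𝓝 (z₀, v₀), p.2 = v₀ :=
      ((isOpen_discrete {v₀}).preimage continuous_snd).mem_nhds rfl
    filter_upwards [continuous_fst.continuousAt.eventually (Holonomy.eventually_hol_eq hδ hs hy),
      continuous_fst.continuousAt.eventually (Holonomy.eventually_hol_eq hδ hs hy'), hv]
      -- Moving from `z₀` to `z` multiplies both holonomies on the left by that of `s z₀ z`, which
      -- cancels.
      with ⟨z, v⟩ h1 h2 h3
    simp only at h1 h2 h3
    simp only [h1, h2, h3]
    group
  coordChange_comp y y' y'' z _ v := by group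

/-- The covering space attached to a homomorphism from the fundamental groupoid to a group which is
trivial on all loops of length less than `2δ`. -/
theorem Holonomy.exists_isCoveringMap {M G : Type u} [PseudoEMetricSpace M]
    [ChartedSpace H M] [Bundle.RiemannianBundle (fun x : M ↦ TangentSpace I x)]
    [IsRiemannianManifold I M] [Group G] {h : Holonomy M G}
    (hconn : ∀ y z : M, Nonempty (Homotopic.Quotient y z)) (hδ0 : 0 < δ)
    (hδ : ∀ (y : M) (q : Homotopic.Quotient y y), IsShort I (2 * δ) q → h.hol q = 1) :
    ∃ (Y : Type u) (_ : TopologicalSpace Y) (p : Y → M) (hp : IsCoveringMap p),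
      (∀ x, Nonempty (p ⁻¹' {x} ≃ G)) ∧ (∀ x, IsTrivialOver p (Metric.eball x δ)) ∧
      ∀ (r : ℝ≥0∞) (y : M) (q : Homotopic.Quotient y y), IsShort I r q →
        (∀ e, hp.monodromy q e = e) → h.hol q = 1 := by
  classical
  let _ : TopologicalSpace G := ⊥
  have _ : DiscreteTopology G := ⟨rfl⟩
  have hs : ∀ y z : M, ∃ q : Homotopic.Quotient y z, edist y z < δ → IsShort I δ q := by
    intro y z
    by_cases hyz : edist y z < δ
    · obtain ⟨q, hq⟩ := exists_isShort (I := I) hyz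
      exact ⟨q, fun _ ↦ hq⟩
    · exact ⟨(hconn y z).some, fun h ↦ (hyz h).elim⟩
  choose s hs using hs
  let C := Holonomy.bundleCore hδ0 hδ hs
  have hp : IsCoveringMap C.proj := FiberBundle.isCoveringMap (F := G) (E := C.Fiber)
  refine ⟨C.TotalSpace, inferInstance, C.proj, hp, fun x ↦ ?_, fun x ↦ ?_, ?_⟩
  · exact ⟨((C.localTriv x).preimageSingletonHomeomorph
      (Metric.mem_eball_self hδ0 : x ∈ Metric.eball x δ)).toEquiv⟩
  · exact isTrivialOver_baseSet hp.isLocalHomeomorph (C.localTriv x)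
  · rintro r y _ ⟨a, rfl, ha, -, -, hr⟩ hmon
    -- The horizontal lift of `a` starting at `1`; its end point has coordinate `h.hol` of `a`, so
    -- trivial monodromy forces that value to be `1`.
    let Γ (t : unitInterval) : C.TotalSpace := ⟨a t, h.hol (Homotopic.Quotient.mk (a.subpath 0 t))⟩
    have hΓ : Continuous Γ := by
      rw [continuous_iff_continuousAt]
      intro t₀
      rw [FiberBundle.continuousAt_totalSpace G]
      refine ⟨a.continuous.continuousAt, ?_⟩
      refine (continuousAt_const
        (y := h.hol (Homotopic.Quotient.mk (a.subpath 0 t₀)))).congr ?_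
      have h1 := eventually_isShort_subpath a ha (hr.trans_le le_top).ne t₀ hδ0.ne'
      have h2 : ∀ᶠ t in 𝓝 t₀, edist (a t₀) (a t) < δ := by
        filter_upwards [a.continuous.continuousAt.eventually
          (Metric.eball_mem_nhds (a t₀) hδ0)] with t ht
        rwa [edist_comm]
      filter_upwards [h1, h2] with t ht1 ht2
      -- In the chart centred at `a t₀` the coordinate of `Γ t` is constant for `t` near `t₀`.
      change _ = (h.hol (s (a t₀) (a t)))⁻¹ * h.hol (s (a t) (a t)) *
        h.hol (Homotopic.Quotient.mk (a.subpath 0 t))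
      have e1 : h.hol (s (a t) (a t)) = 1 := hδ _ _ ((hs _ _ (by simpa using hδ0)).mono (by
        rw [two_mul]
        exact le_self_add))
      have e2 : h.hol (s (a t₀) (a t)) = h.hol (Homotopic.Quotient.mk (a.subpath t₀ t)) :=
        hol_eq_of_isShort hδ (hs _ _ ht2) ht1 (two_mul δ).ge
      have e3 : Homotopic.Quotient.mk (a.subpath 0 t) =
          (Homotopic.Quotient.mk (a.subpath 0 t₀)).trans
            (Homotopic.Quotient.mk (a.subpath t₀ t)) := by
        rw [← Homotopic.Quotient.mk_trans, Homotopic.Quotient.eq]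
        exact ⟨(Path.Homotopy.subpathTransSubpath a 0 t₀ t).symm⟩
      rw [e1, e2, e3, h.hol_trans]
      group
    let Γ' : Path (Γ 0) (Γ 1) := ⟨⟨Γ, hΓ⟩, rfl, rfl⟩
    have hm : hp.monodromy (Homotopic.Quotient.mk a) ⟨Γ 0, a.source⟩ = ⟨Γ 1, a.target⟩ :=
      hp.monodromy_eq_of_map_eq (Homotopic.Quotient.mk Γ') rfl
    rw [hmon] at hm
    have hsnd : ∀ u v : C.TotalSpace, u = v → (u.2 : G) = v.2 := by
      rintro u _ rfl
      rfl
    have h01 : h.hol (Homotopic.Quotient.mk (a.subpath 0 0)) =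
        h.hol (Homotopic.Quotient.mk (a.subpath 0 1)) :=
      hsnd _ _ (congrArg Subtype.val hm)
    rw [Path.subpath_self, Homotopic.Quotient.mk_refl, h.hol_refl, Path.subpath_zero_one,
      Homotopic.Quotient.mk_cast, h.hol_cast] at h01
    exact h01.symm

end Holonomy

/-- The homomorphism from the fundamental groupoid to a quotient of the fundamental group obtained
by choosing paths from the base point to all points. -/
noncomputable def Holonomy.ofPaths {X : Type*} [TopologicalSpace X] {x₀ : X} (c : ∀ y, Homotopic.Quotient x₀ y)
    (N : Subgroup (FundamentalGroup X x₀)) [N.Normal] : Holonomy X (FundamentalGroup X x₀ ⧸ N) where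
  hol {y z} q :=
    QuotientGroup.mk (FundamentalGroup.fromPath ((c y).trans (q.trans (c z).symm)))
  hol_trans {x y z} q q' := by
    rw [← QuotientGroup.mk_mul, FundamentalGroup.mul_def]
    congr 1
    simp only [Homotopic.Quotient.trans_assoc]
    rw [← Homotopic.Quotient.trans_assoc (c y).symm, Homotopic.Quotient.symm_trans,
      Homotopic.Quotient.refl_trans]

/-! ### Normality of the filtration and the covering realising each step -/

section Filtration

universe u

variable {n : ℕ} {M : Type*} [MetricSpace M] [ChartedSpace (EuclideanSpace ℝ (Fin n)) M]
    [Bundle.RiemannianBundle (fun x : M ↦ TangentSpace (𝓡 n) x)] {x₀ : M}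

theorem minMarkedLength_conj_lt {γ : FundamentalGroup M x₀} {r : ℝ≥0∞}
    (hγ : minMarkedLength (n := n) γ < r) (g : FundamentalGroup M x₀) :
    minMarkedLength (n := n) (g * γ * g⁻¹) < r := by
  obtain ⟨y, c, q, hq, rfl⟩ := minMarkedLength_lt_iff.1 hγ
  refine minMarkedLength_lt_iff.2
    ⟨y, Homotopic.Quotient.trans (Homotopic.Quotient.symm g) c, q, hq, ?_⟩
  obtain ⟨g, rfl⟩ := Homotopic.Quotient.mk_surjective g
  obtain ⟨c, rfl⟩ := Homotopic.Quotient.mk_surjective c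
  rw [FundamentalGroup.mul_def, FundamentalGroup.mul_def, FundamentalGroup.inv_def]
  simp only [Homotopic.Quotient.trans_assoc]
  congr 3
  rw [← Homotopic.Quotient.mk_symm, ← Homotopic.Quotient.mk_symm, ← Homotopic.Quotient.mk_trans,
    ← Homotopic.Quotient.mk_trans, ← Homotopic.Quotient.mk_symm, Path.trans_symm, Path.symm_symm]

instance lengthFiltration_normal (δ : ℝ) : (lengthFiltration
    (fun γ : FundamentalGroup M x₀ ↦ minMarkedLength (n := n) γ) δ).Normal := by
  refine ⟨fun γ hγ g ↦ ?_⟩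
  have : lengthFiltration (fun γ : FundamentalGroup M x₀ ↦ minMarkedLength (n := n) γ) δ ≤
      (lengthFiltration (fun γ : FundamentalGroup M x₀ ↦ minMarkedLength (n := n) γ) δ).comap
        (MulAut.conj g).toMonoidHom :=
    (Subgroup.closure_le _).2 fun γ hγ ↦ Subgroup.subset_closure (minMarkedLength_conj_lt hγ g)
  exact this hγ

/-- The covering space attached to a step `Fil^δ` of the length filtration is `δ/2`-trivial, but
not `ε/2`-trivial when `Fil^ε` is not contained in `Fil^δ`. -/
theorem exists_isCoveringMap_lengthFiltration {M : Type u} [MetricSpace M]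
    [ChartedSpace (EuclideanSpace ℝ (Fin n)) M]
    [Bundle.RiemannianBundle (fun x : M ↦ TangentSpace (𝓡 n) x)]
    [IsRiemannianManifold (𝓡 n) M] (x₀ : M) {δ : ℝ} (hδ : 0 < δ) :
    ∃ (Y : Type u) (_ : TopologicalSpace Y) (p : Y → M), IsCoveringMap p ∧
      (∀ x x' : M, Cardinal.mk (p ⁻¹' {x}) = Cardinal.mk (p ⁻¹' {x'})) ∧
      IsDeltaTrivial p (ENNReal.ofReal (δ / 2)) ∧
      ∀ ε : ℝ, IsDeltaTrivial p (ENNReal.ofReal (ε / 2)) →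
        lengthFiltration (fun γ : FundamentalGroup M x₀ ↦ minMarkedLength (n := n) γ) ε ≤
          lengthFiltration (fun γ : FundamentalGroup M x₀ ↦ minMarkedLength (n := n) γ) δ := by
  have hconn : ∀ y z : M, Nonempty (Homotopic.Quotient y z) := fun y z ↦
    ⟨(exists_isShort (I := 𝓡 n) (edist_lt_top y z)).choose⟩
  let c (y : M) : Homotopic.Quotient x₀ y := (hconn x₀ y).some
  let N := lengthFiltration (fun γ : FundamentalGroup M x₀ ↦ minMarkedLength (n := n) γ) δ
  let h : Holonomy M (FundamentalGroup M x₀ ⧸ N) := Holonomy.ofPaths c N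
  obtain ⟨Y, _, p, hp, hfib, htriv, hmon⟩ := Holonomy.exists_isCoveringMap (I := 𝓡 n) (h := h)
    (δ := ENNReal.ofReal (δ / 2)) hconn (ENNReal.ofReal_pos.2 (half_pos hδ)) fun y q hq ↦ by
      rw [two_mul_ofReal_half] at hq
      exact (QuotientGroup.eq_one_iff _).2
        (Subgroup.subset_closure (minMarkedLength_lt_iff.2 ⟨y, c y, q, hq, rfl⟩))
  refine ⟨Y, _, p, hp, fun x x' ↦ ?_, htriv, fun ε hε ↦ ?_⟩
  · obtain ⟨e⟩ := hfib x
    obtain ⟨e'⟩ := hfib x'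
    exact Cardinal.mk_congr (e.trans e'.symm)
  · refine (Subgroup.closure_le _).2 fun γ hγ ↦ ?_
    obtain ⟨y, c', q, hq, rfl⟩ := minMarkedLength_lt_iff.1 hγ
    have hq1 : h.hol q = 1 := hmon _ y q hq
      ((isTrivialOver_eball_iff (I := 𝓡 n) hp).1 hε y q (by rwa [two_mul_ofReal_half]))
    have h1 : h.hol (c'.trans (q.trans c'.symm)) = 1 := by
      rw [h.hol_trans, h.hol_trans, hq1, h.hol_symm, mul_one, inv_mul_cancel]
    have h3 := (QuotientGroup.eq_one_iff _).1 h1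
    -- The chosen loop `c x₀` need not be trivial, so `h3` only concerns a conjugate of the class;
    -- normality undoes this.
    have h4 := (lengthFiltration_normal (n := n) (x₀ := x₀) δ).conj_mem _ h3
      (FundamentalGroup.fromPath (c x₀))
    convert h4 using 1
    rw [FundamentalGroup.mul_def, FundamentalGroup.mul_def, FundamentalGroup.inv_def]
    simp only [Homotopic.Quotient.trans_assoc]
    rw [Homotopic.Quotient.symm_trans, Homotopic.Quotient.trans_refl,
      ← Homotopic.Quotient.trans_assoc (Homotopic.Quotient.symm _),
      Homotopic.Quotient.symm_trans, Homotopic.Quotient.refl_trans]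
    rfl

end Filtration

/-! ### Bounds on the covering radius -/

section CoveringRadius

variable {X Y : Type*} [MetricSpace X] [TopologicalSpace Y] {p : Y → X}

theorem IsDeltaTrivial.mono {δ ε : ℝ≥0∞} (h : IsDeltaTrivial p ε) (hp : IsCoveringMap p)
    (hδ : δ ≤ ε) : IsDeltaTrivial p δ := fun x ↦
  (h x).mono hp.isLocalHomeomorph (Metric.eball_subset_eball hδ)

theorem isDeltaTrivial_of_lt_coveringRadius {δ : ℝ≥0∞} (hp : IsCoveringMap p)
    (hδ : δ < coveringRadius p) : IsDeltaTrivial p δ := by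
  obtain ⟨ε, hε, hδε⟩ := lt_sSup_iff.1 hδ
  exact IsDeltaTrivial.mono hε hp hδε.le

/-- A Lebesgue number of a cover by evenly covered open sets is a lower bound. -/
theorem coveringRadius_pos [CompactSpace X] (hp : IsCoveringMap p) : 0 < coveringRadius p := by
  choose U hU hxU htriv using hp.exists_isTrivialOver
  obtain ⟨δ, hδ, h⟩ := lebesgue_number_lemma_of_emetric (isCompact_univ (X := X)) hU
    fun x _ ↦ Set.mem_iUnion.2 ⟨x, hxU x⟩
  refine hδ.trans_le (le_sSup fun x ↦ ?_)
  obtain ⟨i, hi⟩ := h x (Set.mem_univ x)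
  exact (htriv i).mono hp.isLocalHomeomorph hi

theorem coveringRadius_ne_top [CompactSpace X] [Nonempty X] (hp : IsCoveringMap p)
    (h : ¬ IsTrivialOver p Set.univ) : coveringRadius p ≠ ⊤ := by
  intro htop
  refine h ?_
  have hd : Metric.ediam (Set.univ : Set X) < ⊤ :=
    (isCompact_univ (X := X)).isBounded.ediam_ne_top.lt_top
  -- A ball of radius beyond the diameter is the whole space.
  obtain ⟨ε, hdε, hε⟩ := exists_between hd
  have hball := isDeltaTrivial_of_lt_coveringRadius hp (htop ▸ hε) (Classical.arbitrary X)
  convert hball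
  exact (Set.eq_univ_of_forall fun y ↦ (Metric.edist_le_ediam_of_mem (Set.mem_univ _)
    (Set.mem_univ _)).trans_lt hdε).symm

end CoveringRadius

end CoveringSpectrum

open CoveringSpectrum in
theorem proposition2p6 (n : ℕ) (M : Type*) [MetricSpace M] [CompactSpace M] [ConnectedSpace M]
    [ChartedSpace (EuclideanSpace ℝ (Fin n)) M] [IsManifold (𝓡 n) ∞ M]
    [Bundle.RiemannianBundle (fun x : M ↦ TangentSpace (𝓡 n) x)]
    [IsContMDiffRiemannianBundle (𝓡 n) ∞ (EuclideanSpace ℝ (Fin n))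
      (fun x : M ↦ TangentSpace (𝓡 n) x)]
    [IsRiemannianManifold (𝓡 n) M] (x₀ : M) :
    CoveringSpectrum.covSpec M =
      (fun δ : ℝ ↦ ENNReal.ofReal (δ / 2)) ''
        CoveringSpectrum.jumpSet (CoveringSpectrum.lengthFiltration
          (fun γ : FundamentalGroup M x₀ ↦ CoveringSpectrum.minMarkedLength (n := n) γ)) := by
  ext r
  constructor
  · rintro ⟨Y, _, p, hp, -, hnt, rfl⟩
    have hpos := coveringRadius_pos hp
    have htop : coveringRadius p ≠ ⊤ :=
      have : Nonempty M := ⟨x₀⟩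
      coveringRadius_ne_top hp hnt
    have hr : 0 < (coveringRadius p).toReal := ENNReal.toReal_pos hpos.ne' htop
    have hof : ENNReal.ofReal (2 * (coveringRadius p).toReal / 2) = coveringRadius p := by
      rw [mul_div_cancel_left₀ _ two_ne_zero, ENNReal.ofReal_toReal htop]
    refine ⟨2 * (coveringRadius p).toReal, ⟨by positivity, fun ε hε heq ↦ ?_⟩, hof⟩
    have hlt : coveringRadius p < ENNReal.ofReal (ε / 2) := by
      rw [← hof]
      exact (ENNReal.ofReal_lt_ofReal_iff (by linarith)).2 (by linarith)
    refine hlt.not_ge (le_sSup ((isDeltaTrivial_iff (n := n) hp x₀ ε).2 ?_))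
    rw [← heq, lengthFiltration, Subgroup.closure_le]
    intro γ hγ
    -- Left continuity of the filtration: the supremum defining the radius need not be attained a
    -- priori, but each generator already lies in `Fil^t` for some `t` below twice the radius.
    obtain ⟨t, ht, htδ⟩ := exists_between
      (show minMarkedLength (n := n) γ < ENNReal.ofReal _ from hγ)
    have ht_top : t ≠ ⊤ := htδ.ne_top
    have htr : t.toReal < 2 * (coveringRadius p).toReal :=
      (ENNReal.lt_ofReal_iff_toReal_lt ht_top).1 htδ
    have hdt : IsDeltaTrivial p (ENNReal.ofReal (t.toReal / 2)) := by
      refine isDeltaTrivial_of_lt_coveringRadius hp ?_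
      rw [← hof]
      exact (ENNReal.ofReal_lt_ofReal_iff (by linarith)).2 (by linarith)
    refine (isDeltaTrivial_iff (n := n) hp x₀ t.toReal).1 hdt (Subgroup.subset_closure ?_)
    rw [Set.mem_ofPred, ENNReal.ofReal_toReal ht_top]
    exact ht
  · rintro ⟨δ, ⟨hδ, hjump⟩, rfl⟩
    obtain ⟨Y, _, p, hp, hcard, htriv, hmax⟩ :=
      exists_isCoveringMap_lengthFiltration (n := n) x₀ hδ
    have hnot : ∀ ε : ℝ, δ < ε → ¬ IsDeltaTrivial p (ENNReal.ofReal (ε / 2)) := fun ε hε h ↦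
      hjump ε hε (le_antisymm (Subgroup.closure_mono fun γ hγ ↦
        lt_of_lt_of_le (show _ < _ from hγ) (ENNReal.ofReal_le_ofReal hε.le)) (hmax ε h))
    refine ⟨Y, _, p, hp, hcard, fun h ↦ ?_, le_antisymm (le_sSup htriv) (sSup_le fun ε hε ↦ ?_)⟩
    -- Any number above `δ` would serve: a trivial covering is trivial over all balls.
    · exact hnot (δ + 1) (by linarith) fun x ↦ h.mono hp.isLocalHomeomorph (Set.subset_univ _)
    · by_contra! hlt
      obtain ⟨t, ht, htε⟩ := exists_between hlt
      have ht_top : t ≠ ⊤ := htε.ne_top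
      refine hnot (2 * t.toReal) ?_ (IsDeltaTrivial.mono hε hp ?_)
      · have := (ENNReal.ofReal_lt_iff_lt_toReal (by linarith) ht_top).1 ht
        linarith
      · rw [mul_div_cancel_left₀ _ two_ne_zero, ENNReal.ofReal_toReal ht_top]
        exact htε.le
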